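/- \textbf{Setting.} Let $\Omega$ be a finite set of states equipped with a $\sigma$-algebra $\mathcal F$ of events, and let $(T,\Sigma,\mu)$ be a complete, finite, positive measure space of agents that is atomless: every $A\in\Sigma$ with $\mu(A)>0$ contains some $B\in\Sigma$ with $0<\mu(B)<\mu(A)$. Let $Y$ be an ordered (real) Banach space whose positive cone $Y_+=\{y: y\ge 0\}$ is closed and has nonempty interior; write $x\gg 0$ if $x\in\operatorname{int}Y_+$, and $x>0$ if $x\in Y_+\setminus\{0\}$. Each agent $t\in T$ has a partition $\Pi_t$ of $\Omega$, generating the $\sigma$-algebra $\mathcal F_t$; a utility function $U_t:\Omega\times Y_+\to\mathbb R$; an initial endowment $a(t,\cdot):\Omega\to Y_+$ constant on the cells of $\Pi_t$; and a prior $q_t$, a probability measure on $\Omega$ with $q_t(\omega)>0$ for all $\omega\in\Omega$. The functions $a(\cdot,\omega)$ are Bochner integrable. Put $V_t(x)=\sum_{\omega\in\Omega}U_t(\omega,x(\omega))\,q_t(\omega)$ for $x:\Omega\to Y_+$, and $T_{\mathcal Q}=\{t\in T:\Pi_t=\mathcal Q\}$ for a partition $\mathcal Q$ of $\Omega$. A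 \emph{coalition} is a set $S\in\Sigma$ with $\mu(S)>0$; a \emph{sub-coalition} of $S$ is a coalition contained in $S$. For a coalition $S$, $\bigvee\mathfrak P_S$ is the $\sigma$-algebra generated by the smallest common refinement of all partitions $\mathcal Q$ with $S\cap T_{\mathcal Q}\neq\emptyset$. An \emph{$S$-assignment} is a function $g:S\times\Omega\to Y_+$ with $g(\cdot,\omega)$ Bochner integrable on $S$ for every $\omega$; it is \emph{$S$-exactly feasible} if $\int_S g(\cdot,\omega)\,d\mu=\int_S a(\cdot,\omega)\,d\mu$ for all $\omega\in\Omega$. An \emph{exactly feasible allocation} is a $T$-exactly feasible $T$-assignment $f$ such that $f(t,\cdot)$ is $\mathcal F_t$-measurable for almost all $t\in T$. An allocation $f$ is \emph{NY-strongly fine blocked} by a coalition $S$ if there are a sub-coalition $S_0$ of $S$ and an $S$-exactly feasible $S$-assignment $g$ such that, for almost all $t\in S$, $g(t,\cdot)$ is $\bigvee\mathfrak P_S$-measurable and $V_t(g(t,\cdot))\ge V_t(f(t,\cdot))$, and $V_t(g(t,\cdot))>V_t(f(t,\cdot))$ for almost all $t\in S_0$. The \emph{NY-strong fine core} is the set of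 exactly feasible allocations that are not NY-strongly fine blocked by any coalition. \textbf{Theorem.} Assume: \begin{itemize} \item[(A$_1$)] $t\mapsto q_t$ is Borel measurable into the unit simplex of $\mathbb R^\Omega$, and $T_{\mathcal Q}\in\Sigma$ for every partition $\mathcal Q$ of $\Omega$; \item[(A$_2$)] $t\mapsto U_t(\omega,x)$ is measurable for all $(\omega,x)\in\Omega\times Y_+$, and $U_t(\omega,\cdot)$ is norm-continuous on $Y_+$ for all $(t,\omega)\in T\times\Omega$; \item[(A$_3'$)] $U_t(\omega,x+y)>U_t(\omega,x)$ for all $(t,\omega)\in T\times\Omega$ and all $x,y\in Y_+$ with $y>0$; \item[(A$_4'$)] $U_t(\omega,\cdot)$ is concave on $Y_+$ for all $(t,\omega)\in T\times\Omega$; \item[(A$_5$)] $a(t,\omega)\gg 0$ for all $(t,\omega)\in T\times\Omega$. \end{itemize} Let $f$ be an exactly feasible allocation that is not in the NY-strong fine core. Then for every $\epsilon$ with $0<\epsilon<\mu(T)$ there is a coalition $S$ with $\mu(S)=\epsilon$ by which $f$ is NY-strongly fine blocked. -/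

import Mathlib

open MeasureTheory Set

namespace AsymInfo

/-- The σ-algebra on `Ω` generated by a partition of `Ω`. A partition is encoded by its
equivalence relation `Q`, and `Q.classes` is the collection of its cells. -/
abbrev sigmaOf {Ω : Type*} (Q : Setoid Ω) : MeasurableSpace Ω :=
  MeasurableSpace.generateFrom Q.classes

/-- `⋁ 𝔔`: the σ-algebra generated by the smallest common refinement of the partitions in `𝔔`.
Finer partitions are smaller setoids, so the smallest common refinement is the infimum (two states
are in the same cell iff they are in the same cell of every member of `𝔔`). -/
abbrev joinSigma {Ω : Type*} (𝔔 : Set (Setoid Ω)) : MeasurableSpace Ω :=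
  sigmaOf (sInf 𝔔)

/-- A random bundle `x : Ω → Y` is measurable for the σ-algebra `m` on the states and the Borel
σ-algebra of the commodity space. -/
def BundleMeasurable {Ω Y : Type*} [TopologicalSpace Y] (m : MeasurableSpace Ω) (x : Ω → Y) :
    Prop :=
  @Measurable Ω Y m (borel Y) x

/-- `x ≫ 0`: `x` is an interior point of the positive cone. -/
def StrictlyPos {Y : Type*} [TopologicalSpace Y] [Zero Y] [LE Y] (x : Y) : Prop :=
  x ∈ interior {y : Y | 0 ≤ y}

/-- An exchange economy with asymmetric information: finite state space `Ω`, measurable space of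
agents `T`, commodity space `Y`, consumption set `Y₊ = {y | 0 ≤ y}` in every state. -/
structure Economy (Ω T Y : Type*) [Fintype Ω] [MeasurableSpace T]
    [NormedAddCommGroup Y] [NormedSpace ℝ Y] [PartialOrder Y] where
  /-- the σ-algebra of events -/
  events : MeasurableSpace Ω
  /-- the complete, finite, positive measure on the agents -/
  μ : Measure T
  finite : IsFiniteMeasure μ
  complete : μ.IsComplete
  /-- the private information partition `Π_t` -/
  info : T → Setoid Ω
  /-- the state-dependent utility `U_t(ω, x)`; only its values for `0 ≤ x` are ever relevant -/
  U : T → Ω → Y → ℝ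
  /-- the random initial endowment `a(t, ω)` -/
  a : T → Ω → Y
  a_nonneg : ∀ t ω, 0 ≤ a t ω
  a_info : ∀ t, BundleMeasurable (sigmaOf (info t)) (a t)
  a_integrable : ∀ ω, Integrable (fun t => a t ω) μ
  /-- the prior `q_t`, a probability vector on `Ω` -/
  prior : T → stdSimplex ℝ Ω
  prior_pos : ∀ t ω, 0 < (prior t : Ω → ℝ) ω

namespace Economy

variable {Ω T Y : Type*} [Fintype Ω] [MeasurableSpace T]
  [NormedAddCommGroup Y] [NormedSpace ℝ Y] [PartialOrder Y]

/-- Ex ante expected utility `V_t(x) = ∑_ω U_t(ω, x(ω)) q_t(ω)`. -/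
def V (E : Economy Ω T Y) (t : T) (x : Ω → Y) : ℝ :=
  ∑ ω, E.U t ω (x ω) * (E.prior t : Ω → ℝ) ω

/-- A coalition: a measurable set of agents of positive measure. -/
def IsCoalition (E : Economy Ω T Y) (S : Set T) : Prop :=
  MeasurableSet S ∧ 0 < E.μ S

/-- `T_Q`: the agents whose information partition is `Q`. -/
def typeSet (E : Economy Ω T Y) (Q : Setoid Ω) : Set T := {t | E.info t = Q}

/-- `𝔓_S`: the partitions `Q` with `S ∩ T_Q ≠ ∅`. -/
def partitionsOf (E : Economy Ω T Y) (S : Set T) : Set (Setoid Ω) :=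
  {Q | (S ∩ E.typeSet Q).Nonempty}

/-- An `S`-assignment: `f(·, ω)` is a Bochner integrable function from `S` into `Y₊` for every
`ω`. The values of `f` outside `S` play no role. -/
def IsAssignment (E : Economy Ω T Y) (S : Set T) (f : T → Ω → Y) : Prop :=
  (∀ t ∈ S, ∀ ω, 0 ≤ f t ω) ∧ ∀ ω, IntegrableOn (fun t => f t ω) S E.μ

/-- An `S`-allocation: an `S`-assignment such that almost every agent of `S` receives a bundle
measurable for their private information. -/
def IsAllocation (E : Economy Ω T Y) (S : Set T) (f : T → Ω → Y) : Prop :=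
  E.IsAssignment S f ∧
    ∀ᵐ t ∂(E.μ.restrict S), BundleMeasurable (sigmaOf (E.info t)) (f t)

/-- `S`-exact feasibility: `∫_S f(·, ω) dμ = ∫_S a(·, ω) dμ` in every state. -/
def ExactlyFeasible (E : Economy Ω T Y) (S : Set T) (f : T → Ω → Y) : Prop :=
  ∀ ω, ∫ t in S, f t ω ∂E.μ = ∫ t in S, E.a t ω ∂E.μ

/-- `f` is NY-strongly fine blocked by the coalition `S`. -/
def NYStronglyFineBlocks (E : Economy Ω T Y) (S : Set T) (f : T → Ω → Y) : Prop :=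
  E.IsCoalition S ∧
  ∃ S₀ : Set T, E.IsCoalition S₀ ∧ S₀ ⊆ S ∧
  ∃ g : T → Ω → Y, E.IsAssignment S g ∧ E.ExactlyFeasible S g ∧
    (∀ᵐ t ∂(E.μ.restrict S), BundleMeasurable (joinSigma (E.partitionsOf S)) (g t) ∧
      E.V t (f t) ≤ E.V t (g t)) ∧
    (∀ᵐ t ∂(E.μ.restrict S₀), E.V t (f t) < E.V t (g t))

/-- The NY-strong fine core: the exactly feasible allocations that no coalition NY-strongly fine
blocks. -/
def NYStrongFineCore (E : Economy Ω T Y) : Set (T → Ω → Y) :=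
  {f | E.IsAllocation univ f ∧ E.ExactlyFeasible univ f ∧
    ∀ S : Set T, ¬ E.NYStronglyFineBlocks S f}

/-- The measure space of agents has no `μ`-atoms: every measurable set of positive measure has a
measurable subset of strictly smaller positive measure. -/
def Atomless (E : Economy Ω T Y) : Prop :=
  ∀ A : Set T, MeasurableSet A → 0 < E.μ A →
    ∃ B ⊆ A, MeasurableSet B ∧ 0 < E.μ B ∧ E.μ B < E.μ A

/-- Measurability of priors and of private information. -/
def MeasurableCharacteristics (E : Economy Ω T Y) : Prop :=
  Measurable E.prior ∧ ∀ Q : Setoid Ω, MeasurableSet (E.typeSet Q)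

/-- `(t, x) ↦ U_t(ω, x)` is a Carathéodory function on `T × Y₊` for every `ω`. -/
def CaratheodoryUtility (E : Economy Ω T Y) : Prop :=
  (∀ ω, ∀ x : Y, 0 ≤ x → Measurable (fun t => E.U t ω x)) ∧
  ∀ t ω, ContinuousOn (E.U t ω) {x : Y | 0 ≤ x}

/-- Strong monotonicity of the utilities. -/
def StronglyMonotoneUtility (E : Economy Ω T Y) : Prop :=
  ∀ t ω, ∀ x y : Y, 0 ≤ x → 0 < y → E.U t ω x < E.U t ω (x + y)

/-- Concavity of the utilities on `Y₊`. -/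
def ConcaveUtility (E : Economy Ω T Y) : Prop :=
  ∀ t ω, ConcaveOn ℝ {x : Y | 0 ≤ x} (E.U t ω)

/-- Strict positivity of the endowments. -/
def StrictlyPositiveEndowment (E : Economy Ω T Y) : Prop :=
  ∀ t ω, StrictlyPos (E.a t ω)

end Economy

end AsymInfo

section

open scoped ENNReal Topology
open Filter

namespace MeasureTheory

/-! ### Ranges of atomless measures and of Bochner integrals over subsets -/

section Atomless

variable {α : Type*} [MeasurableSpace α] {μ : Measure α} [IsFiniteMeasure μ]

/-! From a blocking pair `(S, g)` one manufactures a strict improvement `k` on almost all of `S`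
with `∫_S (a - k) ≫ 0` in every state. Monotonicity lets strictly improved agents give up a little
of `g`, which is shared over all of `S` (`exists_strict_improvement`). Mixing the result with half
of the endowments on a large part of `S` then frees resources, since endowments are `≫ 0`
(`exists_slack_improvement`).

The slack is what makes an infinite-dimensional commodity space harmless. There Lyapunov's theorem
gives only approximate convexity of the range of a vector measure, but an approximation error is
absorbed by an open condition such as `≫ 0`. Only the measure of the subset must be exact, and that
is a scalar matter (`exists_measurable_subset_setIntegral_mem`).

For `ε ≤ μ(S)`, a subset of `S` of measure `ε` keeps nearly the proportional surplus `∫ (a - k)`; a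
null set of representatives keeps the pooled information intact. For `ε > μ(S)`, a piece `B` of the
complement joins and keeps `f`, while `S` consumes a convex combination of `k` and `f`. The
proportions are chosen so that the net trades of `f` on `S` and on `B` almost cancel, by feasibility
of `f`. In both cases the leftover is shared equally (`nyStronglyFineBlocks_of_le`). -/

theorem exists_measurable_subset_measure_le_half
    (hμ : ∀ A, MeasurableSet A → 0 < μ A → ∃ B ⊆ A, MeasurableSet B ∧ 0 < μ B ∧ μ B < μ A)
    {A : Set α} (hA : MeasurableSet A) (h0 : 0 < μ A) :
    ∃ B ⊆ A, MeasurableSet B ∧ 0 < μ B ∧ μ B ≤ 2⁻¹ * μ A := by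
  obtain ⟨B, hBA, hB, hB0, hlt⟩ := hμ A hA h0
  have hsum : μ B + μ (A \ B) = μ A := by
    rw [← measure_union disjoint_sdiff_self_right (hA.diff hB), union_sdiff_cancel hBA]
  have hhalf : 2⁻¹ * μ A + 2⁻¹ * μ A = μ A := by
    rw [← add_mul, ENNReal.inv_two_add_inv_two, one_mul]
  rcases le_total (μ B) (2⁻¹ * μ A) with h | h
  · exact ⟨B, hBA, hB, hB0, h⟩
  · refine ⟨A \ B, sdiff_subset, hA.diff hB, ?_, ?_⟩
    · rw [pos_iff_ne_zero]
      intro h'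
      rw [h', add_zero] at hsum
      exact hlt.ne hsum
    · by_contra! h'
      have : 2⁻¹ * μ A + 2⁻¹ * μ A < μ B + μ (A \ B) :=
        ENNReal.add_lt_add_of_le_of_lt
          (ENNReal.mul_ne_top (by simp) (measure_ne_top μ A)) h h'
      rw [hsum, hhalf] at this
      exact lt_irrefl _ this

/-- Iterated halving: after `n` steps the measure is positive and at most `2⁻¹ ^ n * μ A`. -/
theorem exists_measurable_subset_measure_le
    (hμ : ∀ A, MeasurableSet A → 0 < μ A → ∃ B ⊆ A, MeasurableSet B ∧ 0 < μ B ∧ μ B < μ A)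
    {A : Set α} (hA : MeasurableSet A) (h0 : 0 < μ A) {δ : ℝ≥0∞} (hδ : 0 < δ) :
    ∃ B ⊆ A, MeasurableSet B ∧ 0 < μ B ∧ μ B ≤ δ := by
  have key : ∀ n : ℕ, ∃ B ⊆ A, MeasurableSet B ∧ 0 < μ B ∧ μ B ≤ 2⁻¹ ^ n * μ A := by
    intro n
    induction n with
    | zero => exact ⟨A, Subset.rfl, hA, h0, by simp⟩
    | succ n ih =>
      obtain ⟨B, hBA, hB, hB0, hle⟩ := ih
      obtain ⟨C, hCB, hC, hC0, hCle⟩ := exists_measurable_subset_measure_le_half hμ hB hB0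
      refine ⟨C, hCB.trans hBA, hC, hC0, hCle.trans ?_⟩
      rw [pow_succ', mul_assoc]
      gcongr
  have hne : δ / μ A ≠ 0 := (ENNReal.div_pos hδ.ne' (measure_ne_top μ A)).ne'
  obtain ⟨n, hn⟩ := ENNReal.exists_inv_two_pow_lt hne
  obtain ⟨B, hBA, hB, hB0, hle⟩ := key n
  refine ⟨B, hBA, hB, hB0, hle.trans ?_⟩
  calc 2⁻¹ ^ n * μ A ≤ δ / μ A * μ A := by gcongr
    _ ≤ δ := (ENNReal.div_mul_cancel h0.ne' (measure_ne_top μ A)).le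

/-- **Sierpiński's theorem**: a finite atomless measure takes all intermediate values. -/
theorem exists_measurable_subset_measure_eq
    (hμ : ∀ A, MeasurableSet A → 0 < μ A → ∃ B ⊆ A, MeasurableSet B ∧ 0 < μ B ∧ μ B < μ A)
    {A : Set α} (hA : MeasurableSet A) {c : ℝ≥0∞} (hc : c ≤ μ A) :
    ∃ B ⊆ A, MeasurableSet B ∧ μ B = c := by
  have hctop : c ≠ ∞ := ne_top_of_le_ne_top (measure_ne_top μ A) hc
  let P : Set α → Prop := fun B => B ⊆ A ∧ MeasurableSet B ∧ μ B ≤ c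
  -- Greedy exhaustion: each step adds a set of more than half the supremal measure that can still
  -- be added without exceeding `c`, unless that supremum is zero.
  have step : ∀ B : {B // P B}, ∃ B' : {B // P B}, B.1 ⊆ B'.1 ∧
      ∀ C ⊆ A \ B.1, MeasurableSet C → μ B.1 + μ C ≤ c → μ B.1 + μ C / 2 ≤ μ B'.1 := by
    rintro ⟨B, hBA, hB, hBc⟩
    set s : ℝ≥0∞ := sSup {r | ∃ C ⊆ A \ B, MeasurableSet C ∧ μ B + μ C ≤ c ∧ μ C = r} with hs
    have hle : ∀ C ⊆ A \ B, MeasurableSet C → μ B + μ C ≤ c → μ C ≤ s :=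
      fun C h1 h2 h3 => le_sSup ⟨C, h1, h2, h3, rfl⟩
    have hs_top : s ≠ ∞ := by
      refine ne_top_of_le_ne_top hctop (sSup_le ?_)
      rintro r ⟨C, -, -, h, rfl⟩
      exact le_add_self.trans h
    rcases eq_or_ne s 0 with h0 | h0
    · refine ⟨⟨B, hBA, hB, hBc⟩, Subset.rfl, fun C h1 h2 h3 => ?_⟩
      have : μ C = 0 := le_antisymm ((hle C h1 h2 h3).trans h0.le) zero_le
      simp [this]
    · obtain ⟨r, ⟨C₀, hC₀, hC₀m, hC₀c, rfl⟩, hlt⟩ := lt_sSup_iff.1 (ENNReal.half_lt_self h0 hs_top)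
      have hun : μ (B ∪ C₀) = μ B + μ C₀ :=
        measure_union (disjoint_sdiff_self_right.mono_right hC₀) hC₀m
      refine ⟨⟨B ∪ C₀, union_subset hBA (hC₀.trans sdiff_subset), hB.union hC₀m, hun ▸ hC₀c⟩,
        subset_union_left, fun C h1 h2 h3 => ?_⟩
      simp only [hun]
      gcongr
      exact (ENNReal.div_le_div_right (hle C h1 h2 h3) 2).trans hlt.le
  choose next hsub hnext using step
  let b : ℕ → {B // P B} := fun n =>
    n.rec ⟨∅, empty_subset _, MeasurableSet.empty, by simp⟩ fun _ B => next B
  have hbs : ∀ n, b (n + 1) = next (b n) := fun n => rfl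
  have hmono : Monotone fun n => (b n).1 := monotone_nat_of_le_succ fun n => by
    simpa only [hbs] using hsub (b n)
  set U := ⋃ n, (b n).1 with hU
  have hUm : MeasurableSet U := MeasurableSet.iUnion fun n => (b n).2.2.1
  have hUA : U ⊆ A := iUnion_subset fun n => (b n).2.1
  have hUc : μ U ≤ c := by
    rw [hU, hmono.measure_iUnion]
    exact iSup_le fun n => (b n).2.2.2
  refine ⟨U, hUA, hUm, hUc.antisymm ?_⟩
  by_contra! hlt
  have hpos : 0 < μ (A \ U) := by
    rw [measure_sdiff hUA hUm.nullMeasurableSet (measure_ne_top μ U)]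
    exact tsub_pos_of_lt (hlt.trans_le hc)
  obtain ⟨C, hCA, hC, hC0, hCle⟩ :=
    exists_measurable_subset_measure_le hμ (hA.diff hUm) hpos (tsub_pos_of_lt hlt)
  -- If the limit set had measure below `c`, the small set `C` would have been admissible at every
  -- stage, so every stage would have gained at least `μ C / 2`, which is impossible under the
  -- finite bound `c`.
  have hgrow : ∀ n : ℕ, n * (μ C / 2) ≤ μ (b n).1 := by
    intro n
    induction n with
    | zero => simp
    | succ n ih =>
      have hsubU : (b n).1 ⊆ U := subset_iUnion (fun n => (b n).1) n
      have h1 : μ (b n).1 + μ C ≤ c := calc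
        μ (b n).1 + μ C ≤ μ U + (c - μ U) := by gcongr
        _ = c := add_tsub_cancel_of_le hUc
      have h2 := hnext (b n) C (hCA.trans (sdiff_subset_sdiff_right hsubU)) hC h1
      rw [hbs]
      refine le_trans ?_ h2
      push_cast
      rw [add_mul, one_mul]
      gcongr
  obtain ⟨n, hn⟩ := ENNReal.exists_nat_mul_gt (ENNReal.half_pos hC0.ne').ne' hctop
  exact absurd ((hgrow n).trans (b n).2.2.2) hn.not_ge

/-- Singletons need not be measurable, so atomlessness is applied to the measurable hull of `{x}`. A
proper piece or its complement contains `x` and has measure below that of the hull, contradicting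
minimality. -/
theorem measure_singleton_eq_zero_of_atomless
    (hμ : ∀ A, MeasurableSet A → 0 < μ A → ∃ B ⊆ A, MeasurableSet B ∧ 0 < μ B ∧ μ B < μ A)
    (x : α) : μ {x} = 0 := by
  by_contra h0
  have hM := measure_toMeasurable (μ := μ) {x}
  have hMm := measurableSet_toMeasurable μ {x}
  have hxM : x ∈ toMeasurable μ {x} := subset_toMeasurable μ {x} rfl
  obtain ⟨B, hBM, hB, hB0, hlt⟩ := hμ _ hMm (hM ▸ pos_iff_ne_zero.2 h0)
  by_cases hx : x ∈ B
  · exact absurd (measure_mono (singleton_subset_iff.2 hx)) (hM ▸ hlt).not_ge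
  · have h1 : μ {x} ≤ μ (toMeasurable μ {x} \ B) :=
      measure_mono (singleton_subset_iff.2 ⟨hxM, hx⟩)
    have h2 : μ (toMeasurable μ {x} \ B) < μ (toMeasurable μ {x}) := by
      rw [measure_sdiff hBM hB.nullMeasurableSet (measure_ne_top μ B)]
      exact ENNReal.sub_lt_self (measure_ne_top _ _) (hB0.trans hlt).ne' hB0.ne'
    exact absurd h1 (hM ▸ h2).not_ge

/-- An approximate version of **Lyapunov's convexity theorem** in a Banach space, with exact control
of the measure of the subset. -/
theorem exists_measurable_subset_setIntegral_mem
    (hμ : ∀ A, MeasurableSet A → 0 < μ A → ∃ B ⊆ A, MeasurableSet B ∧ 0 < μ B ∧ μ B < μ A)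
    {F : Type*} [NormedAddCommGroup F] [NormedSpace ℝ F] [CompleteSpace F]
    {Φ : α → F} (hΦ : Integrable Φ μ) {S : Set α} (hS : MeasurableSet S) {θ : ℝ} (h0 : 0 ≤ θ)
    (h1 : θ ≤ 1) {N : Set F} (hN : N ∈ 𝓝 (θ • ∫ t in S, Φ t ∂μ)) :
    ∃ R ⊆ S, MeasurableSet R ∧ μ.real R = θ * μ.real S ∧ ∫ t in R, Φ t ∂μ ∈ N := by
  obtain ⟨ε, hε, hball⟩ := Metric.mem_nhds_iff.1 hN
  obtain ⟨s, hs, hsL⟩ := (memLp_one_iff_integrable.2 hΦ).exists_simpleFunc_eLpNorm_sub_lt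
    ENNReal.one_ne_top (ε := ENNReal.ofReal (ε / 2)) (by simpa using hε)
  have hsI : Integrable s μ := memLp_one_iff_integrable.1 hsL
  have hdI : Integrable (fun t => Φ t - s t) μ := hΦ.sub hsI
  have hd : ∫ t, ‖Φ t - s t‖ ∂μ < ε / 2 := by
    rw [integral_norm_eq_lintegral_enorm hdI.aestronglyMeasurable]
    rw [eLpNorm_one_eq_lintegral_enorm] at hs
    exact (ENNReal.lt_ofReal_iff_toReal_lt (ne_top_of_lt hs)).1 hs
  have hθ1 : ENNReal.ofReal θ ≤ 1 := by simpa using ENNReal.ofReal_le_ofReal h1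
  -- Taking the exact proportion `θ` of every fibre of the simple function `s` makes both `μ` and `∫
  -- s` scale exactly by `θ`; the only error comes from `Φ - s`, at most `ε / 2` over `R` and again
  -- over `S`.
  have hex : ∀ y, ∃ B ⊆ s ⁻¹' {y} ∩ S, MeasurableSet B ∧
      μ B = ENNReal.ofReal θ * μ (s ⁻¹' {y} ∩ S) := fun y =>
    exists_measurable_subset_measure_eq hμ ((s.measurableSet_fiber y).inter hS)
      (by simpa using mul_le_mul_left hθ1 (μ (s ⁻¹' {y} ∩ S)))
  choose B hBsub hBm hBμ using hex
  let R := ⋃ y ∈ s.range, B y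
  have hRm : MeasurableSet R := Finset.measurableSet_biUnion _ fun y _ => hBm y
  have hRS : R ⊆ S := iUnion₂_subset fun y _ => (hBsub y).trans inter_subset_right
  have hfib : ∀ y ∈ s.range, s ⁻¹' {y} ∩ R = B y := by
    intro y hy
    ext t
    simp only [R, mem_inter_iff, mem_preimage, mem_singleton_iff, mem_iUnion, exists_prop]
    constructor
    · rintro ⟨rfl, z, -, hz⟩
      have : s t = z := (hBsub z hz).1
      rwa [this]
    · exact fun ht => ⟨(hBsub y ht).1, y, hy, ht⟩
  have hreal : ∀ y ∈ s.range, μ.real (s ⁻¹' {y} ∩ R) = θ * μ.real (s ⁻¹' {y} ∩ S) := by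
    intro y hy
    rw [hfib y hy, Measure.real, hBμ, ENNReal.toReal_mul, ENNReal.toReal_ofReal h0, Measure.real]
  have hpart : ∀ A, MeasurableSet A → ∑ y ∈ s.range, μ.real (s ⁻¹' {y} ∩ A) = μ.real A := by
    intro A hA
    rw [← measureReal_biUnion_finset (fun y _ z _ hyz => ?_)
      (fun y _ => (s.measurableSet_fiber y).inter hA)]
    · congr 1
      ext t
      simp
    · exact (disjoint_left.2 fun t h h' => hyz (h.symm.trans h')).mono inter_subset_left
        inter_subset_left
  have hsint : ∫ t in R, s t ∂μ = θ • ∫ t in S, s t ∂μ := by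
    rw [SimpleFunc.integral_eq_sum _ hsI.integrableOn, SimpleFunc.integral_eq_sum _ hsI.integrableOn,
      Finset.smul_sum]
    refine Finset.sum_congr rfl fun y hy => ?_
    rw [measureReal_restrict_apply (s.measurableSet_fiber y),
      measureReal_restrict_apply (s.measurableSet_fiber y), hreal y hy, mul_smul]
  refine ⟨R, hRS, hRm, ?_, hball ?_⟩
  · rw [← hpart R hRm, ← hpart S hS, Finset.mul_sum]
    exact Finset.sum_congr rfl hreal
  · have hle : ∀ A, ‖∫ t in A, (Φ t - s t) ∂μ‖ < ε / 2 := fun A =>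
      (norm_integral_le_integral_norm _).trans_lt ((setIntegral_le_integral hdI.norm
        (ae_of_all _ fun t => norm_nonneg _)).trans_lt hd)
    have heq : (∫ t in R, Φ t ∂μ) - θ • ∫ t in S, Φ t ∂μ =
        (∫ t in R, (Φ t - s t) ∂μ) - θ • ∫ t in S, (Φ t - s t) ∂μ := by
      rw [integral_sub hΦ.integrableOn hsI.integrableOn, integral_sub hΦ.integrableOn
        hsI.integrableOn, hsint, smul_sub]
      abel
    rw [mem_ball_iff_norm, heq]
    refine (norm_sub_le _ _).trans_lt ?_
    have : ‖θ • ∫ t in S, (Φ t - s t) ∂μ‖ ≤ ‖∫ t in S, (Φ t - s t) ∂μ‖ := by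
      rw [norm_smul, Real.norm_of_nonneg h0]
      exact mul_le_of_le_one_left (norm_nonneg _) h1
    linarith [hle R, hle S]

end Atomless

/-- A Carathéodory function, continuous on a closed set `K`, composed with a strongly measurable
map into `K`. -/
theorem aemeasurable_caratheodory_comp {α Y : Type*} [MeasurableSpace α] {μ : Measure α}
    [TopologicalSpace Y] [TopologicalSpace.PseudoMetrizableSpace Y] {K : Set Y} (hK : IsClosed K)
    {u : α → Y → ℝ}
    (hu : ∀ x ∈ K, Measurable fun t => u t x) (hc : ∀ t, ContinuousOn (u t) K)
    {x : α → Y} (hx : AEStronglyMeasurable x μ) (hxK : ∀ t, x t ∈ K) :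
    AEMeasurable (fun t => u t (x t)) μ := by
  borelize Y
  let _ := TopologicalSpace.pseudoMetrizableSpacePseudoMetric Y
  rcases isEmpty_or_nonempty α with hα | ⟨⟨t₀⟩⟩
  · exact (measurable_of_empty _).aemeasurable
  obtain ⟨y, hy, hyK, hxy⟩ := hx.exists_stronglyMeasurable_range_subset hK.measurableSet
    ⟨x t₀, hxK t₀⟩ (ae_of_all _ hxK)
  -- `Y` may be nonseparable, but the range of `y` is separable, so simple functions with values in
  -- this range, hence in `K`, approximate `y` and continuity on `K` applies.
  have hsep : TopologicalSpace.SeparableSpace (range y) := hy.isSeparable_range.separableSpace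
  let s : ℕ → SimpleFunc α Y := SimpleFunc.approxOn y hy.measurable (range y) (y t₀)
    (mem_range_self t₀)
  have hsK : ∀ n t, s n t ∈ K := fun n t => by
    obtain ⟨r, hr⟩ := SimpleFunc.approxOn_mem (s := range y) hy.measurable (mem_range_self t₀) n t
    rw [show s n t = y r from hr.symm]
    exact hyK r
  have hlim : ∀ t, Tendsto (fun n => s n t) atTop (𝓝 (y t)) := fun t =>
    SimpleFunc.tendsto_approxOn (s := range y) hy.measurable (mem_range_self t₀) (subset_closure (mem_range_self t))
  have hsm : ∀ n, Measurable fun t => u t (s n t) := by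
    intro n
    have hr : ∀ z ∈ (s n).range, z ∈ K := by
      intro z hz
      obtain ⟨t, rfl⟩ := SimpleFunc.mem_range.1 hz
      exact hsK n t
    have : (fun t => u t (s n t)) =
        fun t => ∑ z ∈ (s n).range, ((s n) ⁻¹' {z}).indicator (fun t => u t z) t := by
      funext t
      rw [Finset.sum_eq_single (s n t)]
      · simp
      · intro z _ hz
        rw [indicator_of_notMem]
        exact fun h => hz h.symm
      · exact fun h => absurd (SimpleFunc.mem_range_self _ t) h
    rw [this]
    exact Finset.measurable_fun_sum _ fun z hz =>
      (hu z (hr z hz)).indicator ((s n).measurableSet_fiber z)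
  have hm : Measurable fun t => u t (y t) := by
    refine measurable_of_tendsto_metrizable hsm (tendsto_pi_nhds.2 fun t => ?_)
    exact (hc t (y t) (hyK t)).tendsto.comp (tendsto_nhdsWithin_iff.2
      ⟨hlim t, Eventually.of_forall fun n => hsK n t⟩)
  refine hm.aemeasurable.congr ?_
  filter_upwards [hxy] with t ht
  rw [ht]

end MeasureTheory

/-! ### The interior of the positive cone -/

section OrderedSpace

variable {Y : Type*} [NormedAddCommGroup Y] [PartialOrder Y]

theorem add_mem_interior_nonneg [IsOrderedAddMonoid Y] {x y : Y} (hx : x ∈ interior {y : Y | 0 ≤ y})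
    (hy : 0 ≤ y) : x + y ∈ interior {y : Y | 0 ≤ y} := by
  have hopen : IsOpen ((fun z => z + y) '' interior {y : Y | 0 ≤ y}) :=
    (Homeomorph.addRight y).isOpenMap _ isOpen_interior
  refine interior_maximal ?_ hopen ⟨x, hx, rfl⟩
  rintro _ ⟨z, hz, rfl⟩
  exact add_nonneg (interior_subset hz : z ∈ {y : Y | 0 ≤ y}) hy

variable [NormedSpace ℝ Y]

theorem smul_mem_interior_nonneg [IsOrderedModule ℝ Y] {c : ℝ} (hc : 0 < c) {x : Y}
    (hx : x ∈ interior {y : Y | 0 ≤ y}) : c • x ∈ interior {y : Y | 0 ≤ y} := by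
  have hopen : IsOpen ((fun z => c • z) '' interior {y : Y | 0 ≤ y}) :=
    (Homeomorph.smulOfNeZero c hc.ne').isOpenMap _ isOpen_interior
  refine interior_maximal ?_ hopen ⟨x, hx, rfl⟩
  rintro _ ⟨z, hz, rfl⟩
  exact smul_nonneg hc.le (interior_subset hz : z ∈ {y : Y | 0 ≤ y})

/-- The Bochner integral of a function with values in the interior of the positive cone lies in the
interior of the positive cone. -/
theorem integral_mem_interior_nonneg [CompleteSpace Y] [IsOrderedAddMonoid Y] [IsOrderedModule ℝ Y]
    [OrderClosedTopology Y] {α : Type*} [MeasurableSpace α] {ν : Measure α} [IsFiniteMeasure ν]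
    (hν : ν ≠ 0) {b : α → Y} (hb : Integrable b ν) (hpos : ∀ t, b t ∈ interior {y : Y | 0 ≤ y}) :
    ∫ t, b t ∂ν ∈ interior {y : Y | 0 ≤ y} := by
  borelize Y
  have : Nonempty α := by
    by_contra h
    rw [not_nonempty_iff] at h
    exact hν (Measure.eq_zero_of_isEmpty ν)
  obtain ⟨t₀⟩ := this
  set u := b t₀
  -- Each `b t` is interior, so it dominates a small multiple of the fixed interior point `u`. Some
  -- `A n` therefore has positive measure, and the integral dominates a positive multiple of `u`.
  let A : ℕ → Set α := fun n => {t | (1 / ((n : ℝ) + 1)) • u ≤ b t}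
  have hcover : ⋃ n, A n = univ := by
    refine eq_univ_of_forall fun t => ?_
    have hlim : Tendsto (fun n : ℕ => b t - (1 / ((n : ℝ) + 1)) • u) atTop (𝓝 (b t)) := by
      simpa using tendsto_const_nhds.sub
        ((tendsto_one_div_add_atTop_nhds_zero_nat (𝕜 := ℝ)).smul_const u)
    obtain ⟨n, hn⟩ := (hlim.eventually (isOpen_interior.mem_nhds (hpos t))).exists
    exact mem_iUnion.2 ⟨n, sub_nonneg.1 (interior_subset hn : _ ∈ {y : Y | 0 ≤ y})⟩
  obtain ⟨n, hn⟩ : ∃ n, ν (A n) ≠ 0 := by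
    by_contra! h
    have := measure_iUnion_null h
    rw [hcover, Measure.measure_univ_eq_zero] at this
    exact hν this
  have hA : NullMeasurableSet (A n) ν :=
    hb.aemeasurable.nullMeasurableSet_preimage (s := Ici ((1 / ((n : ℝ) + 1)) • u))
      isClosed_Ici.measurableSet
  have hc : Integrable ((A n).indicator fun _ => (1 / ((n : ℝ) + 1)) • u) ν :=
    (integrable_const _).indicator₀ hA
  have hsplit : ∫ t, b t ∂ν = ν.real (A n) • (1 / ((n : ℝ) + 1)) • u +
      ∫ t, (b t - (A n).indicator (fun _ => (1 / ((n : ℝ) + 1)) • u) t) ∂ν := by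
    rw [integral_sub hb hc, integral_indicator₀ hA, setIntegral_const]
    abel
  rw [hsplit]
  refine add_mem_interior_nonneg (smul_mem_interior_nonneg ?_ (smul_mem_interior_nonneg
    (by positivity) (hpos t₀))) (integral_nonneg fun t => ?_)
  · exact ENNReal.toReal_pos hn (measure_ne_top _ _)
  · rw [Pi.zero_apply, sub_nonneg]
    by_cases ht : t ∈ A n
    · simpa [ht] using (show (1 / ((n : ℝ) + 1)) • u ≤ b t from ht)
    · simpa [ht] using (interior_subset (hpos t) : b t ∈ {y : Y | 0 ≤ y})

end OrderedSpace

/-! ### Information, expected utility and measurability -/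

namespace AsymInfo

/-- `x` is constant on the cells of the partition `Q`. -/
def ConstOnCells {Ω Y : Type*} (Q : Setoid Ω) (x : Ω → Y) : Prop :=
  ∀ ω ω', Q ω ω' → x ω = x ω'

theorem ConstOnCells.mono {Ω Y : Type*} {Q Q' : Setoid Ω} (hQ : Q' ≤ Q) {x : Ω → Y}
    (hx : ConstOnCells Q x) : ConstOnCells Q' x :=
  fun ω ω' h => hx ω ω' (hQ h)

/-- Sets in the generated σ-algebra are unions of cells; conversely, any union of cells is
measurable because there are finitely many states. -/
theorem bundleMeasurable_sigmaOf_iff {Ω Y : Type*} [Finite Ω] [TopologicalSpace Y] [T1Space Y]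
    {Q : Setoid Ω} {x : Ω → Y} : BundleMeasurable (sigmaOf Q) x ↔ ConstOnCells Q x := by
  constructor
  · intro hx ω ω' h
    have hsat : ∀ s, MeasurableSet[sigmaOf Q] s → ∀ ω ω', Q ω ω' → (ω ∈ s ↔ ω' ∈ s) := by
      intro s hs
      induction s, hs using MeasurableSpace.generateFrom_induction with
      | hC s hs _ =>
        obtain ⟨z, rfl⟩ := hs
        exact fun ω ω' h => ⟨fun h' => Q.trans (Q.symm h) h', fun h' => Q.trans h h'⟩
      | empty => simp
      | compl s _ ih => exact fun ω ω' h => not_congr (ih ω ω' h)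
      | iUnion s _ ih =>
        intro ω ω' h
        simp only [mem_iUnion]
        exact exists_congr fun n => ih n ω ω' h
    let _ : MeasurableSpace Y := borel Y
    have : BorelSpace Y := ⟨rfl⟩
    have hm : MeasurableSet[sigmaOf Q] (x ⁻¹' {x ω'}) := hx (measurableSet_singleton (x ω'))
    exact (hsat _ hm ω ω' h).2 rfl
  · intro hx s _
    have : x ⁻¹' s = ⋃ ω ∈ x ⁻¹' s, {ω' | Q ω' ω} := by
      ext ω
      simp only [mem_iUnion, mem_ofPred_eq, exists_prop]
      constructor
      · exact fun h => ⟨ω, h, Q.refl ω⟩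
      · rintro ⟨ω', h, h'⟩
        rwa [mem_preimage, hx ω ω' h']
    rw [this]
    exact MeasurableSet.biUnion (to_countable _) fun ω _ =>
      MeasurableSpace.measurableSet_generateFrom ⟨ω, rfl⟩

namespace Economy

variable {Ω T Y : Type*} [Fintype Ω] [MeasurableSpace T]
  [NormedAddCommGroup Y] [NormedSpace ℝ Y] [PartialOrder Y] {E : Economy Ω T Y}

theorem V_lt_V_add (hmono : E.StronglyMonotoneUtility) (t : T) {x y : Ω → Y} (hx : 0 ≤ x)
    (hy : 0 ≤ y) {ω : Ω} (hω : y ω ≠ 0) : E.V t x < E.V t (x + y) := by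
  refine Finset.sum_lt_sum (fun ω' _ => ?_) ⟨ω, Finset.mem_univ ω, ?_⟩
  · refine mul_le_mul_of_nonneg_right ?_ (E.prior_pos t ω').le
    rcases eq_or_ne (y ω') 0 with h | h
    · simp [h]
    · exact (hmono t ω' _ _ (hx ω') (lt_of_le_of_ne (hy ω') h.symm)).le
  · exact mul_lt_mul_of_pos_right
      (hmono t ω _ _ (hx ω) (lt_of_le_of_ne (hy ω) hω.symm)) (E.prior_pos t ω)

theorem V_le_V_add (hmono : E.StronglyMonotoneUtility) (t : T) {x y : Ω → Y} (hx : 0 ≤ x)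
    (hy : 0 ≤ y) : E.V t x ≤ E.V t (x + y) := by
  by_cases h : ∃ ω, y ω ≠ 0
  · obtain ⟨ω, hω⟩ := h
    exact (V_lt_V_add hmono t hx hy hω).le
  · push Not at h
    rw [show y = 0 from funext h, add_zero]

theorem V_concave (hconc : E.ConcaveUtility) (t : T) {x y : Ω → Y} (hx : 0 ≤ x) (hy : 0 ≤ y)
    {α β : ℝ} (hα : 0 ≤ α) (hβ : 0 ≤ β) (hαβ : α + β = 1) :
    α * E.V t x + β * E.V t y ≤ E.V t (α • x + β • y) := by
  simp only [V, Finset.mul_sum, ← Finset.sum_add_distrib]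
  refine Finset.sum_le_sum fun ω _ => ?_
  have h := (hconc t ω).2 (hx ω) (hy ω) hα hβ hαβ
  simp only [smul_eq_mul] at h
  calc _ = (α * E.U t ω (x ω) + β * E.U t ω (y ω)) * (E.prior t : Ω → ℝ) ω := by ring
    _ ≤ _ := mul_le_mul_of_nonneg_right h (E.prior_pos t ω).le

theorem tendsto_V (hU : E.CaratheodoryUtility) (t : T) {x : ℕ → Ω → Y} {y : Ω → Y}
    (hx : ∀ n, 0 ≤ x n) (hy : 0 ≤ y) (hlim : Tendsto x atTop (𝓝 y)) :
    Tendsto (fun n => E.V t (x n)) atTop (𝓝 (E.V t y)) := by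
  refine tendsto_finsetSum _ fun ω _ => Tendsto.mul_const _ ?_
  exact (hU.2 t ω (y ω) (hy ω)).tendsto.comp (tendsto_nhdsWithin_iff.2
    ⟨tendsto_pi_nhds.1 hlim ω, Eventually.of_forall fun n => hx n ω⟩)

/-- Bochner integrability gives a.e. measurability only; completeness of `μ` upgrades it to
measurability. -/
theorem measurable_V [OrderClosedTopology Y] (hE : E.MeasurableCharacteristics)
    (hU : E.CaratheodoryUtility) {x : T → Ω → Y} (hx : ∀ ω, Integrable (fun t => x t ω) E.μ)
    (hx0 : ∀ t, 0 ≤ x t) : Measurable fun t => E.V t (x t) := by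
  have := E.complete
  refine Finset.measurable_fun_sum _ fun ω _ => Measurable.mul ?_ ?_
  · exact aemeasurable_iff_measurable.1 (aemeasurable_caratheodory_comp isClosed_Ici
      (fun y hy => hU.1 ω y hy) (fun t => hU.2 t ω) (hx ω).aestronglyMeasurable fun t => hx0 t ω)
  · exact (measurable_pi_apply ω).comp (measurable_subtype_coe.comp hE.1)

theorem constOnCells_of_mem {S : Set T} {t : T} (ht : t ∈ S) {x : Ω → Y}
    (hx : BundleMeasurable (sigmaOf (E.info t)) x) : ConstOnCells (sInf (E.partitionsOf S)) x :=
  (bundleMeasurable_sigmaOf_iff.1 hx).mono (sInf_le (show E.info t ∈ E.partitionsOf S from ⟨t, ht, rfl⟩))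

theorem partitionsOf_mono {S R : Set T} (h : S ⊆ R) : E.partitionsOf S ⊆ E.partitionsOf R :=
  fun _ hQ => hQ.mono (inter_subset_inter_left _ h)

theorem setIntegral_eq_of_constOnCells {Q : Setoid Ω} {S : Set T} {g : T → Ω → Y}
    (hg : ∀ᵐ t ∂E.μ.restrict S, ConstOnCells Q (g t))
    (ω ω' : Ω) (h : Q ω ω') : ∫ t in S, g t ω ∂E.μ = ∫ t in S, g t ω' ∂E.μ :=
  integral_congr_ae (hg.mono fun _ ht => ht ω ω' h)

/-- Every set of agents contains a measurable null set that exhibits all of its private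
information. -/
theorem exists_null_representatives (hT : E.Atomless) (S : Set T) :
    ∃ F ⊆ S, MeasurableSet F ∧ E.μ F = 0 ∧ E.partitionsOf S ⊆ E.partitionsOf F := by
  have := E.finite
  have := E.complete
  have hfin : Finite (Setoid Ω) :=
    Finite.of_injective (fun Q : Setoid Ω => (Q : Ω → Ω → Prop)) fun Q Q' h => Setoid.ext fun ω ω' =>
      iff_of_eq (congrFun (congrFun h ω) ω')
  choose r hr using fun Q : E.partitionsOf S => (Q.2 : (S ∩ E.typeSet Q.1).Nonempty)
  have hnull : E.μ (range r) = 0 := by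
    rw [← iUnion_singleton_eq_range]
    exact measure_iUnion_null fun Q => measure_singleton_eq_zero_of_atomless hT _
  exact ⟨range r, range_subset_iff.2 fun Q => (hr Q).1, measurableSet_of_null hnull, hnull,
    fun Q hQ => ⟨r ⟨Q, hQ⟩, mem_range_self _, (hr ⟨Q, hQ⟩).2⟩⟩

/-! ### Blocking coalitions of prescribed size -/

variable [CompleteSpace Y] [IsOrderedAddMonoid Y] [IsOrderedModule ℝ Y]

/-- A coalition blocks as soon as it can improve without exhausting its endowments: what is left
is shared equally. -/
theorem nyStronglyFineBlocks_of_le (hmono : E.StronglyMonotoneUtility) {f k : T → Ω → Y}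
    (hk : ∀ ω, Integrable (fun t => k t ω) E.μ) (hk0 : ∀ t, 0 ≤ k t) {R S₀ : Set T}
    (hR : MeasurableSet R) (hS₀ : E.IsCoalition S₀) (hsub : S₀ ⊆ R)
    (hconst : ∀ᵐ t ∂E.μ.restrict R, ConstOnCells (sInf (E.partitionsOf R)) (k t))
    (hweak : ∀ᵐ t ∂E.μ.restrict R, E.V t (f t) ≤ E.V t (k t))
    (hstrict : ∀ᵐ t ∂E.μ.restrict S₀, E.V t (f t) < E.V t (k t))
    (hle : ∀ ω, ∫ t in R, k t ω ∂E.μ ≤ ∫ t in R, E.a t ω ∂E.μ) :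
    E.NYStronglyFineBlocks R f := by
  have := E.finite
  have hRpos : 0 < E.μ R := hS₀.2.trans_le (measure_mono hsub)
  have hRreal : 0 < E.μ.real R := ENNReal.toReal_pos hRpos.ne' (measure_ne_top _ _)
  set z : Ω → Y := fun ω =>
    (E.μ.real R)⁻¹ • (∫ t in R, E.a t ω ∂E.μ - ∫ t in R, k t ω ∂E.μ) with hz
  have hz0 : 0 ≤ z := fun ω => smul_nonneg (inv_nonneg.2 hRreal.le) (sub_nonneg.2 (hle ω))
  have haQ : ∀ᵐ t ∂E.μ.restrict R, ConstOnCells (sInf (E.partitionsOf R)) (E.a t) :=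
    (ae_restrict_mem hR).mono fun t ht => constOnCells_of_mem ht (E.a_info t)
  -- The equal share respects the pooled information because the aggregates of `a` and `k` do.
  have hzQ : ConstOnCells (sInf (E.partitionsOf R)) z := fun ω ω' h => by
    simp only [hz]
    rw [setIntegral_eq_of_constOnCells haQ ω ω' h, setIntegral_eq_of_constOnCells hconst ω ω' h]
  refine ⟨⟨hR, hRpos⟩, S₀, hS₀, hsub, fun t => k t + z, ⟨fun t _ => add_nonneg (hk0 t) hz0,
    fun ω => ((hk ω).add (integrable_const _)).integrableOn⟩, fun ω => ?_, ?_, ?_⟩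
  · simp only [Pi.add_apply]
    rw [integral_add (hk ω).integrableOn (integrable_const _), setIntegral_const, hz, smul_smul,
      mul_inv_cancel₀ hRreal.ne', one_smul]
    abel
  · filter_upwards [hconst, hweak] with t ht htw
    refine ⟨bundleMeasurable_sigmaOf_iff.2 fun ω ω' h => ?_,
      htw.trans (V_le_V_add hmono t (hk0 t) hz0)⟩
    simp only [Pi.add_apply]
    rw [ht ω ω' h, hzQ ω ω' h]
  · filter_upwards [hstrict] with t ht
    exact ht.trans_le (V_le_V_add hmono t (hk0 t) hz0)

/-- Blocking with slack by `S` gives blocking coalitions of every smaller size. -/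
theorem exists_blocking_of_le (hT : E.Atomless) (hmono : E.StronglyMonotoneUtility)
    {f k : T → Ω → Y} (hk : ∀ ω, Integrable (fun t => k t ω) E.μ) (hk0 : ∀ t, 0 ≤ k t)
    {S : Set T} (hS : E.IsCoalition S)
    (himp : ∀ᵐ t ∂E.μ.restrict S, ConstOnCells (sInf (E.partitionsOf S)) (k t) ∧
      E.V t (f t) < E.V t (k t))
    (hslack : ∀ ω, StrictlyPos (∫ t in S, E.a t ω ∂E.μ - ∫ t in S, k t ω ∂E.μ))
    {ε : ℝ} (hε : 0 < ε) (hεS : ε ≤ E.μ.real S) :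
    ∃ R, E.μ.real R = ε ∧ E.NYStronglyFineBlocks R f := by
  have := E.finite
  have hSreal : 0 < E.μ.real S := hε.trans_le hεS
  let Φ : T → Ω → Y := fun t ω => E.a t ω - k t ω
  have hΦ : ∀ ω, Integrable (fun t => Φ t ω) E.μ := fun ω => (E.a_integrable ω).sub (hk ω)
  -- The exact proportional surplus is interior to the cone in each of the finitely many states, so
  -- an approximate value is still nonnegative.
  have hN : {v : Ω → Y | ∀ ω, 0 ≤ v ω} ∈ 𝓝 ((ε / E.μ.real S) • ∫ t in S, Φ t ∂E.μ) := by
    have : {v : Ω → Y | ∀ ω, 0 ≤ v ω} = univ.pi fun _ => {y : Y | 0 ≤ y} := by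
      ext v
      simp
    rw [this]
    refine set_pi_mem_nhds finite_univ fun ω _ => mem_interior_iff_mem_nhds.1 ?_
    rw [Pi.smul_apply, eval_integral fun ω => (hΦ ω).integrableOn]
    refine smul_mem_interior_nonneg (div_pos hε hSreal) ?_
    simp only [Φ]
    rw [integral_sub (E.a_integrable ω).integrableOn (hk ω).integrableOn]
    exact hslack ω
  obtain ⟨R, hRS, hR, hRμ, hRN⟩ := exists_measurable_subset_setIntegral_mem hT
    (Integrable.of_eval hΦ) hS.1 (div_pos hε hSreal).le ((div_le_one hSreal).2 hεS) hN
  rw [div_mul_cancel₀ _ hSreal.ne'] at hRμ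
  -- `R` alone may miss some partition present in `S`, and `k` could then fail to be measurable for
  -- the coarser join; adding the null set `F` restores every partition at no cost in measure.
  obtain ⟨F, hFS, hF, hF0, hFP⟩ := exists_null_representatives hT S
  have hae : (R ∪ F : Set T) =ᵐ[E.μ] R := union_ae_eq_left_of_ae_eq_empty (ae_eq_empty.2 hF0)
  have hRFS : R ∪ F ⊆ S := union_subset hRS hFS
  have hRFμ : E.μ.real (R ∪ F) = ε := by rw [measureReal_congr hae, hRμ]
  have himp' := ae_restrict_of_ae_restrict_of_subset hRFS himp
  have hcoal : E.IsCoalition (R ∪ F) :=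
    ⟨hR.union hF, pos_iff_ne_zero.2 fun h0 => hε.ne' (by rw [← hRFμ, Measure.real, h0]; rfl)⟩
  refine ⟨R ∪ F, hRFμ, nyStronglyFineBlocks_of_le hmono hk hk0 hcoal.1 hcoal Subset.rfl
    (himp'.mono fun t ht => ht.1.mono (sInf_le_sInf (hFP.trans
      (partitionsOf_mono subset_union_right))))
    (himp'.mono fun t ht => ht.2.le) (himp'.mono fun t ht => ht.2) fun ω => ?_⟩
  rw [setIntegral_congr_set hae, setIntegral_congr_set hae]
  have h := hRN ω
  rw [eval_integral fun ω => (hΦ ω).integrableOn] at h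
  simp only [Φ] at h
  rw [integral_sub (E.a_integrable ω).integrableOn (hk ω).integrableOn] at h
  exact sub_nonneg.1 h

/-- Blocking with slack by `S` gives blocking coalitions of every larger size. -/
theorem exists_blocking_of_ge (hT : E.Atomless) (hmono : E.StronglyMonotoneUtility)
    (hconc : E.ConcaveUtility) {f k : T → Ω → Y} (hf : ∀ ω, Integrable (fun t => f t ω) E.μ)
    (hf0 : ∀ t, 0 ≤ f t) (hfinfo : ∀ᵐ t ∂E.μ, BundleMeasurable (sigmaOf (E.info t)) (f t))
    (hfeas : E.ExactlyFeasible univ f)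
    (hk : ∀ ω, Integrable (fun t => k t ω) E.μ) (hk0 : ∀ t, 0 ≤ k t)
    {S : Set T} (hS : E.IsCoalition S)
    (himp : ∀ᵐ t ∂E.μ.restrict S, ConstOnCells (sInf (E.partitionsOf S)) (k t) ∧
      E.V t (f t) < E.V t (k t))
    (hslack : ∀ ω, StrictlyPos (∫ t in S, E.a t ω ∂E.μ - ∫ t in S, k t ω ∂E.μ))
    {ε : ℝ} (hεS : E.μ.real S ≤ ε) (hεT : ε < E.μ.real univ) :
    ∃ R, E.μ.real R = ε ∧ E.NYStronglyFineBlocks R f := by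
  have := E.finite
  have hcompl : E.μ.real Sᶜ = E.μ.real univ - E.μ.real S := measureReal_compl hS.1
  have hCpos : 0 < E.μ.real Sᶜ := by linarith
  -- The fraction of the complement of `S` that must join to reach total measure `ε`; `ρ < 1` keeps
  -- part of the slack.
  set ρ : ℝ := (ε - E.μ.real S) / E.μ.real Sᶜ with hρ
  have hρ0 : 0 ≤ ρ := div_nonneg (sub_nonneg.2 hεS) hCpos.le
  have hρ1 : ρ < 1 := (div_lt_one hCpos).2 (by linarith)
  let Φ : T → Ω → Y := fun t ω => E.a t ω - f t ω
  have hΦ : ∀ ω, Integrable (fun t => Φ t ω) E.μ := fun ω => (E.a_integrable ω).sub (hf ω)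
  have hΦS : ∀ (A : Set T) ω, ∫ t in A, Φ t ω ∂E.μ =
      ∫ t in A, E.a t ω ∂E.μ - ∫ t in A, f t ω ∂E.μ := fun A ω =>
    integral_sub (E.a_integrable ω).integrableOn (hf ω).integrableOn
  have hΦT : ∀ ω, ∫ t in Sᶜ, Φ t ω ∂E.μ = -∫ t in S, Φ t ω ∂E.μ := fun ω => by
    have h1 := integral_add_compl hS.1 (hΦ ω)
    have h2 := hΦS univ ω
    rw [hfeas ω, sub_self, setIntegral_univ] at h2
    rw [h2] at h1
    exact eq_neg_of_add_eq_zero_right h1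
  -- The surplus on `S` when it consumes `(1 - ρ) • k + ρ • f`. The newcomers keep `f` and
  -- contribute about `ρ • ∫_{Sᶜ} (a - f) = -ρ • ∫_S (a - f)`, cancelling the second term and
  -- leaving `(1 - ρ)` times the slack.
  let w : Ω → Y := fun ω => (1 - ρ) • (∫ t in S, E.a t ω ∂E.μ - ∫ t in S, k t ω ∂E.μ) +
    ρ • ∫ t in S, Φ t ω ∂E.μ
  have hN : {v : Ω → Y | ∀ ω, 0 ≤ w ω + v ω} ∈ 𝓝 (ρ • ∫ t in Sᶜ, Φ t ∂E.μ) := by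
    have : {v : Ω → Y | ∀ ω, 0 ≤ w ω + v ω} =
        univ.pi fun ω => (fun y => w ω + y) ⁻¹' {y : Y | 0 ≤ y} := by
      ext v
      simp
    rw [this]
    refine set_pi_mem_nhds finite_univ fun ω _ =>
      (continuous_const_add (w ω)).continuousAt.preimage_mem_nhds
        (mem_interior_iff_mem_nhds.1 ?_)
    rw [Pi.smul_apply, eval_integral fun ω => (hΦ ω).integrableOn, hΦT ω]
    have : w ω + ρ • -∫ t in S, Φ t ω ∂E.μ =
        (1 - ρ) • (∫ t in S, E.a t ω ∂E.μ - ∫ t in S, k t ω ∂E.μ) := by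
      simp [w]
    rw [this]
    exact smul_mem_interior_nonneg (sub_pos.2 hρ1) (hslack ω)
  obtain ⟨B, hBS, hB, hBμ, hBN⟩ := exists_measurable_subset_setIntegral_mem hT
    (Integrable.of_eval hΦ) hS.1.compl hρ0 hρ1.le hN
  rw [hρ, div_mul_cancel₀ _ hCpos.ne'] at hBμ
  have hdisj : Disjoint S B := (disjoint_compl_right (a := S)).mono_right hBS
  have hRμ : E.μ.real (S ∪ B) = ε := by
    rw [measureReal_union hdisj hB, hBμ]
    ring
  let l : T → Ω → Y := fun t ω => f t ω + S.indicator (fun t => (1 - ρ) • (k t ω - f t ω)) t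
  have hIind : ∀ ω, Integrable (S.indicator fun t => (1 - ρ) • (k t ω - f t ω)) E.μ := fun ω =>
    (((hk ω).sub (hf ω)).smul (1 - ρ)).indicator hS.1
  have hin : ∀ t ∈ S, l t = (1 - ρ) • k t + ρ • f t := fun t ht => by
    funext ω
    simp only [l, indicator_of_mem ht, Pi.add_apply, Pi.smul_apply]
    module
  have hout : ∀ t ∉ S, l t = f t := fun t ht => by
    funext ω
    simp [l, ht]
  have hstrict : ∀ t ∈ S, E.V t (f t) < E.V t (k t) → E.V t (f t) < E.V t (l t) := by
    intro t ht h
    rw [hin t ht]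
    have := V_concave hconc t (hk0 t) (hf0 t) (sub_nonneg.2 hρ1.le) hρ0 (by ring)
    nlinarith [mul_pos (sub_pos.2 hρ1) (sub_pos.2 h)]
  have himp' : ∀ᵐ t ∂E.μ, t ∈ S → ConstOnCells (sInf (E.partitionsOf S)) (k t) ∧
      E.V t (f t) < E.V t (k t) := (ae_restrict_iff' hS.1).1 himp
  refine ⟨S ∪ B, hRμ, nyStronglyFineBlocks_of_le hmono (k := l) (S₀ := S)
    (fun ω => (hf ω).add (hIind ω)) (fun t => ?_) (hS.1.union hB) hS subset_union_left ?_ ?_ ?_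
    fun ω => ?_⟩
  · by_cases ht : t ∈ S
    · rw [hin t ht]
      exact add_nonneg (smul_nonneg (sub_nonneg.2 hρ1.le) (hk0 t)) (smul_nonneg hρ0 (hf0 t))
    · rw [hout t ht]
      exact hf0 t
  · filter_upwards [ae_restrict_of_ae hfinfo, ae_restrict_of_ae himp',
      ae_restrict_mem (hS.1.union hB)] with t hft hkt htR
    have hfc := constOnCells_of_mem htR hft
    by_cases ht : t ∈ S
    · rw [hin t ht]
      intro ω ω' h
      simp only [Pi.add_apply, Pi.smul_apply]
      rw [hfc ω ω' h, (hkt ht).1.mono (sInf_le_sInf (partitionsOf_mono subset_union_left)) ω ω' h]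
    · rwa [hout t ht]
  · filter_upwards [ae_restrict_of_ae himp'] with t hkt
    by_cases ht : t ∈ S
    · exact (hstrict t ht (hkt ht).2).le
    · rw [hout t ht]
  · filter_upwards [himp, ae_restrict_mem hS.1] with t hkt ht
    exact hstrict t ht hkt.2
  · have h := hBN ω
    rw [eval_integral fun ω => (hΦ ω).integrableOn] at h
    rw [← sub_nonneg]
    refine h.trans_eq ?_
    simp only [w, l]
    rw [integral_add (hf ω).integrableOn (hIind ω).integrableOn, setIntegral_indicator hS.1,
      inter_eq_right.2 subset_union_left, integral_smul,
      integral_sub (hk ω).integrableOn (hf ω).integrableOn,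
      setIntegral_union hdisj hB (hf ω).integrableOn (hf ω).integrableOn,
      setIntegral_union hdisj hB (E.a_integrable ω).integrableOn (E.a_integrable ω).integrableOn,
      hΦS, hΦS]
    module

/-! ### From weak improvement to strict improvement with slack -/

variable [OrderClosedTopology Y]

/-- A weakly improving assignment that improves a sub-coalition strictly can be modified so that it
improves the whole coalition strictly, with unchanged aggregate. -/
theorem exists_strict_improvement (hE : E.MeasurableCharacteristics) (hU : E.CaratheodoryUtility)
    (hmono : E.StronglyMonotoneUtility) {f g : T → Ω → Y}
    (hf : ∀ ω, Integrable (fun t => f t ω) E.μ) (hf0 : ∀ t, 0 ≤ f t)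
    (hg : ∀ ω, Integrable (fun t => g t ω) E.μ) (hg0 : ∀ t, 0 ≤ g t) {S S₀ : Set T}
    (hS₀ : E.IsCoalition S₀) (hsub : S₀ ⊆ S) {Q : Setoid Ω}
    (hQ : ∀ᵐ t ∂E.μ.restrict S, ConstOnCells Q (g t))
    (hweak : ∀ᵐ t ∂E.μ.restrict S, E.V t (f t) ≤ E.V t (g t))
    (hstrict : ∀ᵐ t ∂E.μ.restrict S₀, E.V t (f t) < E.V t (g t)) :
    ∃ h : T → Ω → Y, (∀ t, 0 ≤ h t) ∧ (∀ ω, Integrable (fun t => h t ω) E.μ) ∧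
      (∀ᵐ t ∂E.μ.restrict S, ConstOnCells Q (h t) ∧ E.V t (f t) < E.V t (h t)) ∧
      ∀ ω, ∫ t in S, h t ω ∂E.μ = ∫ t in S, g t ω ∂E.μ := by
  have := E.finite
  let c : ℕ → ℝ := fun n => 1 / ((n : ℝ) + 1)
  have hc0 : ∀ n, 0 < c n := fun n => Nat.one_div_pos_of_nat
  have hc1 : ∀ n, c n ≤ 1 := fun n => by
    simpa [c] using Nat.one_div_le_one_div (α := ℝ) (Nat.zero_le n)
  have hcg0 : ∀ n t, 0 ≤ (1 - c n) • g t := fun n t =>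
    smul_nonneg (sub_nonneg.2 (hc1 n)) (hg0 t)
  -- Agents of `S₀` who still gain after surrendering the fraction `c n`; by continuity these sets
  -- cover almost all of `S₀`.
  let B : ℕ → Set T := fun n => {t | E.V t (f t) < E.V t ((1 - c n) • g t)} ∩ S₀
  have hBm : ∀ n, MeasurableSet (B n) := fun n =>
    (measurableSet_lt (measurable_V hE hU hf hf0)
      (measurable_V hE hU (x := fun t => (1 - c n) • g t) (fun ω => (hg ω).smul (1 - c n))
        (hcg0 n))).inter hS₀.1
  obtain ⟨n, hn⟩ : ∃ n, E.μ (B n) ≠ 0 := by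
    by_contra! h
    have hnull : ∀ᵐ t ∂E.μ.restrict S₀, False := by
      have h' : ∀ᵐ t ∂E.μ, ∀ n, t ∉ B n :=
        ae_all_iff.2 fun n => measure_eq_zero_iff_ae_notMem.1 (h n)
      filter_upwards [hstrict, ae_restrict_of_ae h', ae_restrict_mem hS₀.1] with t ht hB htS
      have hlim : Tendsto (fun n => (1 - c n) • g t) atTop (𝓝 (g t)) := by
        simpa [c] using ((tendsto_const_nhds (x := (1 : ℝ))).sub
          (tendsto_one_div_add_atTop_nhds_zero_nat (𝕜 := ℝ))).smul_const (g t)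
      obtain ⟨n, hn⟩ := ((tendsto_V hU t (fun n => hcg0 n t) (hg0 t) hlim).eventually
        (lt_mem_nhds ht)).exists
      exact hB n ⟨hn, htS⟩
    rw [ae_iff] at hnull
    simp only [not_false_eq_true, ofPred_true, Measure.restrict_apply_univ] at hnull
    exact hS₀.2.ne' hnull
  -- The collected amount must be nonzero. If all such integrals vanished, `g` would be zero a.e. on
  -- `B n`, yet zero cannot be strictly better than `f`.
  obtain ⟨A, hAB, hA, ω₀, hω₀⟩ : ∃ A ⊆ B n, MeasurableSet A ∧ ∃ ω, ∫ t in A, g t ω ∂E.μ ≠ 0 := by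
    by_contra! h
    have hzero : ∀ ω, ∀ᵐ t ∂E.μ.restrict (B n), g t ω = 0 := fun ω => by
      refine (hg ω).integrableOn.ae_eq_zero_of_forall_setIntegral_eq_zero fun s hs _ => ?_
      rw [Measure.restrict_restrict hs]
      exact h _ inter_subset_right (hs.inter (hBm n)) ω
    have hnull : ∀ᵐ t ∂E.μ.restrict (B n), False := by
      filter_upwards [ae_all_iff.2 hzero, ae_restrict_mem (hBm n)] with t ht htB
      have h0 : g t = 0 := funext ht
      have h1 : E.V t (f t) < E.V t ((1 - c n) • g t) := htB.1
      rw [h0, smul_zero] at h1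
      have h2 := V_le_V_add hmono t le_rfl (hf0 t)
      rw [zero_add] at h2
      exact absurd h2 h1.not_ge
    rw [ae_iff] at hnull
    simp only [not_false_eq_true, ofPred_true, Measure.restrict_apply_univ] at hnull
    exact hn hnull
  have hAS : A ⊆ S := hAB.trans (inter_subset_right.trans hsub)
  have hSpos : 0 < E.μ.real S :=
    ENNReal.toReal_pos (hS₀.2.trans_le (measure_mono hsub)).ne' (measure_ne_top _ _)
  set z : Ω → Y := fun ω => (E.μ.real S)⁻¹ • c n • ∫ t in A, g t ω ∂E.μ with hz
  have hz0 : 0 ≤ z := fun ω => smul_nonneg (inv_nonneg.2 hSpos.le)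
    (smul_nonneg (hc0 n).le (integral_nonneg fun t => hg0 t ω))
  have hzne : z ω₀ ≠ 0 := smul_ne_zero (inv_ne_zero hSpos.ne') (smul_ne_zero (hc0 n).ne' hω₀)
  have hzQ : ConstOnCells Q z := fun ω ω' h => by
    simp only [hz]
    rw [setIntegral_eq_of_constOnCells (ae_restrict_of_ae_restrict_of_subset hAS hQ) ω ω' h]
  let h : T → Ω → Y := fun t ω => g t ω - A.indicator (fun t => c n • g t ω) t + z ω
  have hin : ∀ t ∈ A, h t = (1 - c n) • g t + z := fun t ht => by
    funext ω
    simp [h, ht, sub_smul]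
  have hout : ∀ t ∉ A, h t = g t + z := fun t ht => by
    funext ω
    simp [h, ht]
  have hIind : ∀ ω, Integrable (A.indicator fun t => c n • g t ω) E.μ := fun ω =>
    ((hg ω).smul (c n)).indicator hA
  have hIsub : ∀ ω, Integrable (fun t => g t ω - A.indicator (fun t => c n • g t ω) t) E.μ :=
    fun ω => (hg ω).sub (hIind ω)
  refine ⟨h, fun t => ?_, fun ω => (hIsub ω).add (integrable_const _), ?_,
    fun ω => ?_⟩
  · by_cases ht : t ∈ A
    · rw [hin t ht]
      exact add_nonneg (hcg0 n t) hz0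
    · rw [hout t ht]
      exact add_nonneg (hg0 t) hz0
  · filter_upwards [hQ, hweak] with t htQ htw
    by_cases ht : t ∈ A
    · rw [hin t ht]
      refine ⟨fun ω ω' h => ?_, (hAB ht).1.trans_le (V_le_V_add hmono t (hcg0 n t) hz0)⟩
      simp only [Pi.add_apply, Pi.smul_apply]
      rw [htQ ω ω' h, hzQ ω ω' h]
    · rw [hout t ht]
      refine ⟨fun ω ω' h => ?_, htw.trans_lt (V_lt_V_add hmono t (hg0 t) hz0 hzne)⟩
      simp only [Pi.add_apply]
      rw [htQ ω ω' h, hzQ ω ω' h]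
  · simp only [h]
    rw [integral_add (hIsub ω).integrableOn (integrable_const _),
      integral_sub (hg ω).integrableOn (hIind ω).integrableOn, setIntegral_indicator hA,
      inter_eq_right.2 hAS, integral_smul, setIntegral_const, hz, smul_smul,
      mul_inv_cancel₀ hSpos.ne', one_smul]
    abel

/-- Mixing a strictly improving assignment with half of the endowments leaves a strictly positive
amount of every random commodity unused. -/
theorem exists_slack_improvement (hE : E.MeasurableCharacteristics) (hU : E.CaratheodoryUtility)
    (ha : E.StrictlyPositiveEndowment) {f h : T → Ω → Y}
    (hf : ∀ ω, Integrable (fun t => f t ω) E.μ) (hf0 : ∀ t, 0 ≤ f t)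
    (hh : ∀ ω, Integrable (fun t => h t ω) E.μ) (hh0 : ∀ t, 0 ≤ h t) {S : Set T}
    (hS : E.IsCoalition S)
    (himp : ∀ᵐ t ∂E.μ.restrict S, ConstOnCells (sInf (E.partitionsOf S)) (h t) ∧
      E.V t (f t) < E.V t (h t))
    (hfeas : E.ExactlyFeasible S h) :
    ∃ k : T → Ω → Y, (∀ t, 0 ≤ k t) ∧ (∀ ω, Integrable (fun t => k t ω) E.μ) ∧
      (∀ᵐ t ∂E.μ.restrict S, ConstOnCells (sInf (E.partitionsOf S)) (k t) ∧
        E.V t (f t) < E.V t (k t)) ∧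
      ∀ ω, StrictlyPos (∫ t in S, E.a t ω ∂E.μ - ∫ t in S, k t ω ∂E.μ) := by
  have := E.finite
  let c : ℕ → ℝ := fun n => 1 / ((n : ℝ) + 1)
  have hc0 : ∀ n, 0 < c n := fun n => Nat.one_div_pos_of_nat
  have hc1 : ∀ n, c n ≤ 1 := fun n => by
    simpa [c] using Nat.one_div_le_one_div (α := ℝ) (Nat.zero_le n)
  -- Direction chosen so that `h + c n • d = (1 - c n) • h + (c n / 2) • a`, a nonnegative bundle
  -- that uses half of the endowment.
  let d : T → Ω → Y := fun t ω => (1 / 2 : ℝ) • E.a t ω - h t ω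
  have ha2 : ∀ ω, Integrable (fun t => (1 / 2 : ℝ) • E.a t ω) E.μ := fun ω =>
    (E.a_integrable ω).smul (1 / 2 : ℝ)
  have hd : ∀ ω, Integrable (fun t => d t ω) E.μ := fun ω => (ha2 ω).sub (hh ω)
  have hmix0 : ∀ n t, 0 ≤ h t + c n • d t := fun n t => by
    have : h t + c n • d t = (1 - c n) • h t + (c n * (1 / 2)) • E.a t := by
      funext ω
      simp only [d, Pi.add_apply, Pi.smul_apply]
      module
    rw [this]
    exact add_nonneg (smul_nonneg (sub_nonneg.2 (hc1 n)) (hh0 t))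
      (smul_nonneg (mul_nonneg (hc0 n).le (by norm_num)) (E.a_nonneg t))
  let B : ℕ → Set T := fun n => {t | E.V t (f t) < E.V t (h t + c n • d t)} ∩ S
  have hBm : ∀ n, MeasurableSet (B n) := fun n =>
    (measurableSet_lt (measurable_V hE hU hf hf0)
      (measurable_V hE hU (x := fun t => h t + c n • d t)
        (fun ω => (hh ω).add ((hd ω).smul (c n))) (hmix0 n))).inter hS.1
  have hev : ∀ᵐ t ∂E.μ.restrict S, ∀ᶠ n in atTop, t ∈ B n := by
    filter_upwards [himp, ae_restrict_mem hS.1] with t ht htS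
    have hlim : Tendsto (fun n => h t + c n • d t) atTop (𝓝 (h t)) := by
      simpa [c] using (tendsto_const_nhds (x := h t)).add
        ((tendsto_one_div_add_atTop_nhds_zero_nat (𝕜 := ℝ)).smul_const (d t))
    filter_upwards [(tendsto_V hU t (fun n => hmix0 n t) (hh0 t) hlim).eventually
      (lt_mem_nhds ht.2)] with n hn
    exact ⟨hn, htS⟩
  -- No single `n` need suit all agents, so the mixing is confined to `B n`. As `B n` fills `S`
  -- almost everywhere, the freed amount per unit of `c n` tends to `∫_S (h - a/2) = (1/2) ∫_S a ≫
  -- 0`, hence is itself interior for some `n`.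
  have hlim : ∀ ω, Tendsto (fun n => -∫ t in B n, d t ω ∂E.μ) atTop
      (𝓝 ((1 / 2 : ℝ) • ∫ t in S, E.a t ω ∂E.μ)) := fun ω => by
    have h1 : ∀ n, ∫ t in B n, d t ω ∂E.μ =
        ∫ t in S, (B n).indicator (fun t => d t ω) t ∂E.μ := fun n => by
      rw [setIntegral_indicator (hBm n), inter_eq_right.2 (inter_subset_right : B n ⊆ S)]
    have h2 : (1 / 2 : ℝ) • ∫ t in S, E.a t ω ∂E.μ = -∫ t in S, d t ω ∂E.μ := by
      simp only [d]
      rw [integral_sub (ha2 ω).integrableOn (hh ω).integrableOn,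
        integral_smul, hfeas ω]
      module
    simp only [h1, h2]
    refine (tendsto_integral_of_dominated_convergence (fun t => ‖d t ω‖)
      (fun n => ((hd ω).indicator (hBm n)).aestronglyMeasurable.restrict)
      (hd ω).norm.integrableOn (fun n => ae_of_all _ fun t => norm_indicator_le_norm_self _ _)
      ?_).neg
    filter_upwards [hev] with t ht
    exact tendsto_const_nhds.congr' (ht.mono fun n hn => (indicator_of_mem hn _).symm)
  have hSne : E.μ.restrict S ≠ 0 := fun h0 => hS.2.ne' (Measure.restrict_eq_zero.1 h0)
  have hint : ∀ ω, (1 / 2 : ℝ) • ∫ t in S, E.a t ω ∂E.μ ∈ interior {y : Y | 0 ≤ y} := fun ω =>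
    smul_mem_interior_nonneg (by norm_num) (integral_mem_interior_nonneg hSne
      (E.a_integrable ω).integrableOn fun t => ha t ω)
  obtain ⟨n, hn⟩ := (eventually_all.2 fun ω =>
    (hlim ω).eventually (isOpen_interior.mem_nhds (hint ω))).exists
  let k : T → Ω → Y := fun t ω => h t ω + (B n).indicator (fun t => c n • d t ω) t
  have hin : ∀ t ∈ B n, k t = h t + c n • d t := fun t ht => by
    funext ω
    simp [k, ht]
  have hout : ∀ t ∉ B n, k t = h t := fun t ht => by
    funext ω
    simp [k, ht]
  have hIind : ∀ ω, Integrable ((B n).indicator fun t => c n • d t ω) E.μ := fun ω =>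
    ((hd ω).smul (c n)).indicator (hBm n)
  refine ⟨k, fun t => ?_, fun ω => (hh ω).add (hIind ω), ?_, fun ω => ?_⟩
  · by_cases ht : t ∈ B n
    · rw [hin t ht]
      exact hmix0 n t
    · rw [hout t ht]
      exact hh0 t
  · filter_upwards [himp, ae_restrict_mem hS.1] with t ht htS
    by_cases htB : t ∈ B n
    · rw [hin t htB]
      refine ⟨fun ω ω' hω => ?_, htB.1⟩
      simp only [Pi.add_apply, Pi.smul_apply, d]
      rw [ht.1 ω ω' hω, constOnCells_of_mem htS (E.a_info t) ω ω' hω]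
    · rw [hout t htB]
      exact ht
  · have : ∫ t in S, E.a t ω ∂E.μ - ∫ t in S, k t ω ∂E.μ = c n • -∫ t in B n, d t ω ∂E.μ := by
      simp only [k]
      rw [integral_add (hh ω).integrableOn (hIind ω).integrableOn, setIntegral_indicator (hBm n),
        inter_eq_right.2 (inter_subset_right : B n ⊆ S), integral_smul, hfeas ω]
      module
    rw [this]
    exact smul_mem_interior_nonneg (hc0 n) (hn ω)

end Economy

end AsymInfo

end

/-! ### Assembly -/

theorem mainTheorem3 {Ω T Y : Type*} [Fintype Ω] [MeasurableSpace T]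
    [NormedAddCommGroup Y] [NormedSpace ℝ Y] [CompleteSpace Y]
    [PartialOrder Y] [IsOrderedAddMonoid Y] [IsOrderedModule ℝ Y] [OrderClosedTopology Y]
    (hY : (interior {y : Y | 0 ≤ y}).Nonempty)
    (E : AsymInfo.Economy Ω T Y) (hT : E.Atomless)
    (hA1 : E.MeasurableCharacteristics) (hA2 : E.CaratheodoryUtility)
    (hA3' : E.StronglyMonotoneUtility) (hA4' : E.ConcaveUtility)
    (hA5 : E.StrictlyPositiveEndowment)
    (f : T → Ω → Y) (hf : E.IsAllocation Set.univ f) (hfe : E.ExactlyFeasible Set.univ f)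
    (hcore : f ∉ E.NYStrongFineCore)
    (ε : ℝ) (hε : 0 < ε) (hεT : ε < E.μ.real Set.univ) :
    ∃ S : Set T, E.IsCoalition S ∧ E.μ.real S = ε ∧ E.NYStronglyFineBlocks S f := by

  have hf' : ∀ ω, Integrable (fun t => f t ω) E.μ := fun ω => by simpa using hf.1.2 ω
  have hf0 : ∀ t, 0 ≤ f t := fun t ω => hf.1.1 t (mem_univ t) ω
  have hfinfo : ∀ᵐ t ∂E.μ, AsymInfo.BundleMeasurable (AsymInfo.sigmaOf (E.info t)) (f t) := by
    simpa using hf.2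
  obtain ⟨S, hS, S₀, hS₀, hsub, g, hg, hgfeas, hgS, hgS₀⟩ :
      ∃ S, E.NYStronglyFineBlocks S f := by
    by_contra! h
    exact hcore ⟨hf, hfe, h⟩
  -- Values of `g` outside `S` are unconstrained; extension by zero gives global nonnegativity and
  -- integrability.
  let g' : T → Ω → Y := fun t ω => S.indicator (fun t => g t ω) t
  have hg' : ∀ t ∈ S, g' t = g t := fun t ht => by
    funext ω
    simp [g', ht]
  have hgS' : ∀ᵐ t ∂E.μ.restrict S,
      AsymInfo.ConstOnCells (sInf (E.partitionsOf S)) (g' t) ∧ E.V t (f t) ≤ E.V t (g' t) := by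
    filter_upwards [hgS, ae_restrict_mem hS.1] with t ht htS
    rw [hg' t htS]
    exact ⟨AsymInfo.bundleMeasurable_sigmaOf_iff.1 ht.1, ht.2⟩
  obtain ⟨h, hh0, hh, himp, hint⟩ := AsymInfo.Economy.exists_strict_improvement hA1 hA2 hA3' hf' hf0
    (g := g') (fun ω => (integrable_indicator_iff hS.1).2 (hg.2 ω))
    (fun t ω => indicator_apply_nonneg fun ht => hg.1 t ht ω) hS₀ hsub
    (hgS'.mono fun t ht => ht.1) (hgS'.mono fun t ht => ht.2) (by
      filter_upwards [hgS₀, ae_restrict_mem hS₀.1] with t ht htS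
      rwa [hg' t (hsub htS)])
  obtain ⟨k, hk0, hk, hkimp, hslack⟩ := AsymInfo.Economy.exists_slack_improvement hA1 hA2 hA5 hf' hf0
    hh hh0 hS himp fun ω => by
      rw [hint ω, ← hgfeas ω]
      exact setIntegral_congr_fun hS.1 fun t ht => congrFun (hg' t ht) ω
  obtain ⟨R, hRμ, hR⟩ : ∃ R, E.μ.real R = ε ∧ E.NYStronglyFineBlocks R f := by
    rcases le_total ε (E.μ.real S) with hle | hle
    · exact AsymInfo.Economy.exists_blocking_of_le hT hA3' hk hk0 hS hkimp hslack hε hle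
    · exact AsymInfo.Economy.exists_blocking_of_ge hT hA3' hA4' hf' hf0 hfinfo hfe hk hk0 hS hkimp
        hslack hle hεT
  exact ⟨R, hR.1, hRμ, hR⟩
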